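/- For a positive integer $m$, let $\mathrm{Part}(m)$ denote the lattice of all partitions of $\{1,2,\dots,m\}$, ordered by refinement ($U\le V$ if and only if every block of $U$ is contained in a block of $V$). A lattice is called four-generated if it has a generating set consisting of exactly four elements, that is, a four-element subset such that the smallest sublattice containing it (closed under binary joins and meets) is the whole lattice. For every positive integer $u$ there is an integer $N$ such that for every integer $n\ge N$ the direct product of direct powers $$\mathrm{Part}(n)^u\times \mathrm{Part}(n+1)^u\times\dots\times \mathrm{Part}(n+u-1)^u$$ is a four-generated lattice. -/

import Mathlib

/-- The lattice `Part(n)` of all partitions of an `n`-element set (modelled by `Fin n`). A partition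
is a set of nonempty, pairwise disjoint blocks covering the set, and the lattice order is
refinement: `U ≤ V` iff the equivalence relation of `U` is contained in that of `V`. -/
abbrev PartitionLattice (n : ℕ) : Type :=
  Setoid.Partitions (Fin n)

/-- A lattice is four-generated if it has a generating set with exactly four elements, i.e. the
smallest sublattice (subset closed under binary joins and meets) containing it is everything. -/
def IsFourGenerated (L : Type*) [Lattice L] : Prop :=
  ∃ s : Finset L, s.card = 4 ∧ latticeClosure (s : Set L) = Set.univ

/-! Each factor is realised on an integer segment `[-a, b)`, viewed as a path. The coordinates of
the four generators are α, congruence mod 2; β, a matching containing the central edge `{-1, 0}`;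
and γ, δ, the complementary matching split into its left and right halves. So the path alternates β,
γ to the left of the centre and β, δ to the right.

One factor: lattice terms cut α and β down to one side, and two such cuts meet in the atom `{-2, 1}`
(`linkTerm_eq`). Alternating β- and γ-edges walk its left end outwards (`walkTerm_eq`), and
reflection gives the right-hand walk. Together with the three central edges these atoms yield every
atom, hence the whole lattice (`Segment.eq_univ_of_isSublattice`).

Several factors: the `k`-th left walk term is an atom if `2 * k + 2 ≤ a`, and is `⊥` otherwise,
because the walk has left the segment. `spreadTerm` turns these outcomes into `⊤` and `⊥`. One term
therefore separates two factors whose `a / 2` differ; the right walk does the same for `b / 2`. A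
sublattice that projects onto every factor and separates every ordered pair is the full product
(`IsSublattice.eq_univ_of_pi`).

Separation in both directions needs the pairs `(a / 2, b / 2)` to form an antichain. The lengths
differ by less than `u`, so cut points `a` spaced by at least `2 * u` make a larger `a` force a
smaller `b / 2`. -/

/-! ### Joins of kernels and atoms in lattices of equivalence relations -/

/-- The equivalence relation on `V` whose only nontrivial block is `{x, y}`. -/
def pairSetoid {V : Type*} (x y : V) : Setoid V where
  r i j := i = j ∨ (i = x ∧ j = y) ∨ (i = y ∧ j = x)
  iseqv := ⟨fun _ => Or.inl rfl, by grind, by grind⟩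

section PairSetoid

variable {V : Type*}

lemma pairSetoid_apply {x y i j : V} :
    pairSetoid x y i j ↔ i = j ∨ (i = x ∧ j = y) ∨ (i = y ∧ j = x) := Iff.rfl

lemma pairSetoid_le {x y : V} {X : Setoid V} (h : X x y) : pairSetoid x y ≤ X := by
  intro i j hij
  rcases hij with rfl | ⟨rfl, rfl⟩ | ⟨rfl, rfl⟩
  exacts [X.refl _, h, X.symm h]

lemma pairSetoid_rel (x y : V) : pairSetoid x y x y := Or.inr (Or.inl ⟨rfl, rfl⟩)

lemma pairSetoid_self (x : V) : pairSetoid x x = ⊥ :=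
  le_bot_iff.1 (pairSetoid_le ((⊥ : Setoid V).refl x))

lemma pairSetoid_comm (x y : V) : pairSetoid x y = pairSetoid y x :=
  le_antisymm (pairSetoid_le ((pairSetoid y x).symm (pairSetoid_rel y x)))
    (pairSetoid_le ((pairSetoid x y).symm (pairSetoid_rel x y)))

lemma sup_rel_left {X Y : Setoid V} {i j : V} (h : X i j) : (X ⊔ Y) i j :=
  (le_sup_left : X ≤ X ⊔ Y) h

lemma sup_rel_right {X Y : Setoid V} {i j : V} (h : Y i j) : (X ⊔ Y) i j :=
  (le_sup_right : Y ≤ X ⊔ Y) h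

/-- The equivalence relation with only nontrivial block `{x, y, z}`. -/
def tripleSetoid (x y z : V) : Setoid V where
  r i j := i = j ∨ ((i = x ∨ i = y ∨ i = z) ∧ (j = x ∨ j = y ∨ j = z))
  iseqv := ⟨fun _ => Or.inl rfl, by grind, by grind⟩

lemma pairSetoid_sup_pairSetoid_le (x y z : V) :
    pairSetoid x y ⊔ pairSetoid y z ≤ tripleSetoid x y z :=
  sup_le (pairSetoid_le (Or.inr ⟨Or.inl rfl, Or.inr (Or.inl rfl)⟩))
    (pairSetoid_le (Or.inr ⟨Or.inr (Or.inl rfl), Or.inr (Or.inr rfl)⟩))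

lemma pairSetoid_sup_rel (x y z : V) : (pairSetoid x y ⊔ pairSetoid y z) x z :=
  Setoid.trans' _ (sup_rel_left (pairSetoid_rel x y)) (sup_rel_right (pairSetoid_rel y z))

/-- `X` separates `y` from both `x` and `z`, so it cuts the block `{x, y, z}` down to `{x, z}`. -/
lemma pairSetoid_eq_sup_inf {x y z : V} {X : Setoid V} (hxz : X x z) (hxy : ¬ X x y) :
    pairSetoid x z = (pairSetoid x y ⊔ pairSetoid y z) ⊓ X := by
  refine le_antisymm (pairSetoid_le ⟨pairSetoid_sup_rel x y z, hxz⟩) ?_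
  rintro i j ⟨h1, h2⟩
  have hyx : ¬ X y x := fun h => hxy (X.symm h)
  have hyz : ¬ X y z := fun h => hxy (X.trans hxz (X.symm h))
  have hzy : ¬ X z y := fun h => hyz (X.symm h)
  rcases pairSetoid_sup_pairSetoid_le x y z h1 with rfl | ⟨rfl | rfl | rfl, rfl | rfl | rfl⟩
  all_goals first
    | exact Setoid.refl' _ _
    | exact absurd h2 (by assumption)
    | exact pairSetoid_rel _ _
    | exact (pairSetoid _ _).symm (pairSetoid_rel _ _)

variable {T : Set (Setoid V)}

lemma IsSublattice.pairSetoid_mem_of_separating (hT : IsSublattice T) {x y z : V} {X : Setoid V}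
    (hX : X ∈ T) (h1 : pairSetoid x y ∈ T) (h2 : pairSetoid y z ∈ T) (hxz : X x z)
    (hxy : ¬ X x y) : pairSetoid x z ∈ T := by
  rw [pairSetoid_eq_sup_inf hxz hxy]
  exact hT.infClosed (hT.supClosed h1 h2) hX

/-- The blocks `{x, y, z}` and `{x, w, z}` meet in `{x, z}`; this is the diagonal of a 4-cycle of
known atoms. -/
lemma IsSublattice.pairSetoid_mem_of_square (hT : IsSublattice T) {x y z w : V}
    (h1 : pairSetoid x y ∈ T) (h2 : pairSetoid y z ∈ T) (h3 : pairSetoid x w ∈ T)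
    (h4 : pairSetoid w z ∈ T) (hyw : y ≠ w) : pairSetoid x z ∈ T := by
  by_cases hxy : x = y
  · exact hxy ▸ h2
  by_cases hyz : y = z
  · exact hyz ▸ h1
  refine hT.pairSetoid_mem_of_separating (hT.supClosed h3 h4) h1 h2 (pairSetoid_sup_rel x w z) ?_
  intro h
  rcases pairSetoid_sup_pairSetoid_le x w z h with h | ⟨-, h | h | h⟩
  exacts [hxy h, hxy h.symm, hyw h, hyz h]

/-- A sublattice of the equivalence lattice of a finite set that contains the least element and all
the atoms is the whole lattice. -/
lemma IsSublattice.eq_univ_of_pairSetoid_mem [Finite V] (hT : IsSublattice T)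
    (h : ∀ x y, pairSetoid x y ∈ T) (hbot : ⊥ ∈ T) : T = Set.univ := by
  classical
  have := Fintype.ofFinite V
  refine Set.eq_univ_of_forall fun X => ?_
  have key : X = (Finset.univ.filter fun p : V × V => X p.1 p.2).sup
      fun p => pairSetoid p.1 p.2 := by
    refine le_antisymm ?_ (Finset.sup_le fun p hp => pairSetoid_le (by simpa using hp))
    intro i j hij
    exact (Finset.le_sup (f := fun p : V × V => pairSetoid p.1 p.2)
      (Finset.mem_filter.2 ⟨Finset.mem_univ (i, j), hij⟩)) (pairSetoid_rel i j)
  rw [key]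
  exact Finset.sup_induction hbot (fun _ hx _ hy => hT.supClosed hx hy) fun p _ => h p.1 p.2

end PairSetoid

/-! ### Lattice terms -/

section Terms

variable {L M : Type*} [Lattice L] [Lattice M]

/-- Term for `α` restricted to the side of the path carrying `γ`. -/
def sideTerm (α β γ : L) : L := α ⊓ (β ⊔ γ)

/-- Term for `β` restricted to the side of the path carrying `γ`. -/
def sideMatchingTerm (α β γ : L) : L := β ⊓ (γ ⊔ sideTerm α β γ)

/-- Term for the atom joining the two sides of the path. -/
def linkTerm (α β γ δ : L) : L := (γ ⊔ sideTerm α β δ) ⊓ (δ ⊔ sideTerm α β γ)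

/-- Term moving one endpoint of an atom along a `β`-edge. -/
def stepTerm (α β γ z : L) : L := α ⊓ (sideMatchingTerm α β γ ⊔ z)

/-- Iterated term: the endpoint of the linking atom walks `2 * k` edges on the `γ`-side. -/
def walkTerm (α β γ δ : L) : ℕ → L
  | 0 => linkTerm α β γ δ
  | k + 1 => (γ ⊔ stepTerm α β γ (walkTerm α β γ δ k)) ⊓ (sideTerm α β γ ⊔ linkTerm α β γ δ)

/-- Term sending a complement of `α` to the top and the bottom to the bottom. -/
def spreadTerm (α β γ δ z : L) : L := (β ⊓ (z ⊔ α)) ⊔ (γ ⊓ (z ⊔ α)) ⊔ (δ ⊓ (z ⊔ α))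

lemma map_stepTerm (f : LatticeHom L M) (α β γ z : L) :
    f (stepTerm α β γ z) = stepTerm (f α) (f β) (f γ) (f z) := by
  simp [stepTerm, sideMatchingTerm, sideTerm]

/-- Terms commute with projections, so a single term takes its own value in each factor of the
product. -/
lemma map_walkTerm (f : LatticeHom L M) (α β γ δ : L) (k : ℕ) :
    f (walkTerm α β γ δ k) = walkTerm (f α) (f β) (f γ) (f δ) k := by
  induction k with
  | zero => simp [walkTerm, linkTerm, sideTerm]
  | succ k ih => simp [walkTerm, map_stepTerm, ih, linkTerm, sideTerm]

lemma map_spreadTerm (f : LatticeHom L M) (α β γ δ z : L) :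
    f (spreadTerm α β γ δ z) = spreadTerm (f α) (f β) (f γ) (f δ) (f z) := by
  simp [spreadTerm]

variable {T : Set L} {α β γ δ z : L}

lemma IsSublattice.sideTerm_mem (hT : IsSublattice T) (hα : α ∈ T) (hβ : β ∈ T) (hγ : γ ∈ T) :
    sideTerm α β γ ∈ T :=
  hT.infClosed hα (hT.supClosed hβ hγ)

lemma IsSublattice.sideMatchingTerm_mem (hT : IsSublattice T) (hα : α ∈ T) (hβ : β ∈ T)
    (hγ : γ ∈ T) : sideMatchingTerm α β γ ∈ T :=
  hT.infClosed hβ (hT.supClosed hγ (hT.sideTerm_mem hα hβ hγ))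

lemma IsSublattice.stepTerm_mem (hT : IsSublattice T) (hα : α ∈ T) (hβ : β ∈ T) (hγ : γ ∈ T)
    (hz : z ∈ T) : stepTerm α β γ z ∈ T :=
  hT.infClosed hα (hT.supClosed (hT.sideMatchingTerm_mem hα hβ hγ) hz)

lemma IsSublattice.linkTerm_mem (hT : IsSublattice T) (hα : α ∈ T) (hβ : β ∈ T) (hγ : γ ∈ T)
    (hδ : δ ∈ T) : linkTerm α β γ δ ∈ T :=
  hT.infClosed (hT.supClosed hγ (hT.sideTerm_mem hα hβ hδ))
    (hT.supClosed hδ (hT.sideTerm_mem hα hβ hγ))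

lemma IsSublattice.walkTerm_mem (hT : IsSublattice T) (hα : α ∈ T) (hβ : β ∈ T) (hγ : γ ∈ T)
    (hδ : δ ∈ T) (k : ℕ) : walkTerm α β γ δ k ∈ T := by
  induction k with
  | zero => exact hT.linkTerm_mem hα hβ hγ hδ
  | succ k ih =>
    exact hT.infClosed (hT.supClosed hγ (hT.stepTerm_mem hα hβ hγ ih))
      (hT.supClosed (hT.sideTerm_mem hα hβ hγ) (hT.linkTerm_mem hα hβ hγ hδ))

lemma IsSublattice.spreadTerm_mem (hT : IsSublattice T) (hα : α ∈ T) (hβ : β ∈ T) (hγ : γ ∈ T)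
    (hδ : δ ∈ T) (hz : z ∈ T) : spreadTerm α β γ δ z ∈ T :=
  have h := hT.supClosed hz hα
  hT.supClosed (hT.supClosed (hT.infClosed hβ h) (hT.infClosed hγ h)) (hT.infClosed hδ h)

end Terms

/-! ### The four generators on a segment of integers -/

/-- The integers in the interval `[-a, b)`. -/
abbrev Segment (a b : ℕ) : Type := {i : ℤ // -(a : ℤ) ≤ i ∧ i < b}

instance (a b : ℕ) : Finite (Segment a b) := (Set.finite_Ico (-(a : ℤ)) (b : ℤ)).to_subtype

namespace Segment

variable {a b : ℕ}

/-- The equivalence relation on a segment given by the kernel of a function on `ℤ`. -/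
def kerOn (f : ℤ → ℤ) : Setoid (Segment a b) := Setoid.ker fun i => f i.1

/-- The equivalence relation on a segment whose only nontrivial block is `{x, y}`, trivial if `x` or
`y` is not in the segment. -/
def atomAt (x y : ℤ) : Setoid (Segment a b) := Setoid.comap Subtype.val (pairSetoid x y)

/-- Congruence modulo `2`. -/
def parity : Setoid (Segment a b) := kerOn fun i => i % 2

/-- The matching with edges `{2 * k - 1, 2 * k}`. -/
def matching : Setoid (Segment a b) := kerOn fun i => (i + 1) / 2

/-- The matching with edges `{2 * k, 2 * k + 1}` for `k < 0`. -/
def leftMatching : Setoid (Segment a b) := kerOn fun i => if i < 0 then 2 * (i / 2) else i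

/-- The matching with edges `{2 * k, 2 * k + 1}` for `0 ≤ k`. -/
def rightMatching : Setoid (Segment a b) := kerOn fun i => if i < 0 then i else 2 * (i / 2)

section

variable {i j : Segment a b}

lemma kerOn_apply {f : ℤ → ℤ} : kerOn f i j ↔ f i.1 = f j.1 := Iff.rfl

lemma atomAt_apply {x y : ℤ} : atomAt x y i j ↔
    i.1 = j.1 ∨ (i.1 = x ∧ j.1 = y) ∨ (i.1 = y ∧ j.1 = x) := Iff.rfl

lemma parity_apply : parity i j ↔ i.1 % 2 = j.1 % 2 := Iff.rfl

lemma matching_apply : matching i j ↔ (i.1 + 1) / 2 = (j.1 + 1) / 2 := Iff.rfl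

lemma leftMatching_apply : leftMatching i j ↔
    i.1 = j.1 ∨ (i.1 < 0 ∧ j.1 < 0 ∧ i.1 / 2 = j.1 / 2) := by
  change (if i.1 < 0 then 2 * (i.1 / 2) else i.1) = (if j.1 < 0 then 2 * (j.1 / 2) else j.1) ↔ _
  split_ifs <;> omega

lemma rightMatching_apply : rightMatching i j ↔
    i.1 = j.1 ∨ (0 ≤ i.1 ∧ 0 ≤ j.1 ∧ i.1 / 2 = j.1 / 2) := by
  change (if i.1 < 0 then i.1 else 2 * (i.1 / 2)) = (if j.1 < 0 then j.1 else 2 * (j.1 / 2)) ↔ _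
  split_ifs <;> omega

lemma atomAt_val : atomAt i.1 j.1 = pairSetoid i j := by
  ext k l
  simp [atomAt_apply, pairSetoid_apply, Subtype.ext_iff]

/-- The hypothesis is vacuous when an endpoint lies outside the segment. The evaluations below thus
also cover a walk that has run off the end. -/
lemma atomAt_le {x y : ℤ} {X : Setoid (Segment a b)}
    (h : ∀ hx hy, X ⟨x, hx⟩ ⟨y, hy⟩) : atomAt x y ≤ X := by
  rintro ⟨i, hi⟩ ⟨j, hj⟩ (h' | ⟨rfl, rfl⟩ | ⟨rfl, rfl⟩)
  · obtain rfl : i = j := h'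
    exact Setoid.refl' _ _
  · exact h _ _
  · exact X.symm (h _ _)

/-- Upper bounds on joins are obtained throughout by labelling points with integers constant on both
relations; the join then lies below the kernel of the labelling. -/
lemma matching_sup_leftMatching_le : (matching ⊔ leftMatching : Setoid (Segment a b)) ≤
    kerOn fun i => if i ≤ 0 then 0 else (i + 1) / 2 := by
  refine sup_le (fun i j h => ?_) fun i j h => ?_
  · rw [matching_apply] at h; rw [kerOn_apply]; split_ifs <;> omega
  · rw [leftMatching_apply] at h; rw [kerOn_apply]; split_ifs <;> omega

lemma matching_sup_rightMatching_le : (matching ⊔ rightMatching : Setoid (Segment a b)) ≤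
    kerOn fun i => if -1 ≤ i then 0 else (i + 1) / 2 := by
  refine sup_le (fun i j h => ?_) fun i j h => ?_
  · rw [matching_apply] at h; rw [kerOn_apply]; split_ifs <;> omega
  · rw [rightMatching_apply] at h; rw [kerOn_apply]; split_ifs <;> omega

lemma sideTerm_le : sideTerm parity matching leftMatching ≤
    (kerOn fun i => if i ≤ 0 then i % 2 else i + 2 : Setoid (Segment a b)) := by
  rintro i j ⟨h1, h2⟩
  replace h2 := matching_sup_leftMatching_le h2
  rw [parity_apply] at h1
  rw [kerOn_apply] at *
  split_ifs at h2 ⊢ <;> omega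

end

lemma matching_sup_leftMatching_rel_zero (hb : 0 < b) (n : ℕ) (hn : -(a : ℤ) ≤ -n) :
    (matching ⊔ leftMatching : Setoid (Segment a b)) ⟨-n, by omega⟩ ⟨0, by omega⟩ := by
  induction n with
  | zero => exact Setoid.refl' _ _
  | succ n ih =>
    refine Setoid.trans' _ ?_ (ih (by omega))
    rcases Nat.even_or_odd' n with ⟨k, rfl | rfl⟩
    · refine sup_rel_left (matching_apply.2 ?_); push_cast; omega
    · refine sup_rel_right (leftMatching_apply.2 ?_); push_cast; omega

section

variable {i j : Segment a b}

lemma matching_sup_leftMatching_rel (hb : 0 < b) (hi : i.1 ≤ 0) (hj : j.1 ≤ 0) :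
    (matching ⊔ leftMatching) i j := by
  obtain ⟨i, hi'⟩ := i
  obtain ⟨j, hj'⟩ := j
  obtain ⟨m, rfl⟩ := Int.exists_eq_neg_ofNat hi
  obtain ⟨n, rfl⟩ := Int.exists_eq_neg_ofNat hj
  exact Setoid.trans' _ (matching_sup_leftMatching_rel_zero hb m hi'.1)
    (Setoid.symm' _ (matching_sup_leftMatching_rel_zero hb n hj'.1))

lemma sideTerm_rel (hb : 0 < b) (hi : i.1 ≤ 0) (hj : j.1 ≤ 0) (h : i.1 % 2 = j.1 % 2) :
    sideTerm parity matching leftMatching i j :=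
  ⟨h, matching_sup_leftMatching_rel hb hi hj⟩

lemma sideTerm_right_le : sideTerm parity matching rightMatching ≤
    (kerOn fun i => if -1 ≤ i then i % 2 else i : Setoid (Segment a b)) := by
  rintro i j ⟨h1, h2⟩
  replace h2 := matching_sup_rightMatching_le h2
  rw [parity_apply] at h1
  rw [kerOn_apply] at *
  split_ifs at h2 ⊢ <;> omega

lemma leftMatching_sup_sideTerm_rel (ha : 2 ≤ a) (hb : 0 < b) (hi : i.1 ≤ 0) (hj : j.1 ≤ 0) :
    (leftMatching ⊔ sideTerm parity matching leftMatching) i j := by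
  -- Even points reach `-2` by parity; odd ones go to `-1` and cross the edge `{-2, -1}`, which
  -- exists since `2 ≤ a`.
  have key : ∀ i : Segment a b, i.1 ≤ 0 →
      (leftMatching ⊔ sideTerm parity matching leftMatching) i ⟨-2, by omega⟩ := by
    intro i hi
    rcases Int.emod_two_eq_zero_or_one i.1 with h | h
    · exact sup_rel_right (sideTerm_rel hb hi (by simp) (by simp; omega))
    · refine Setoid.trans' _ (sup_rel_right (sideTerm_rel hb hi (j := ⟨-1, by omega⟩)
        (by simp) (by simp; omega))) (sup_rel_left (leftMatching_apply.2 (by simp)))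
  exact Setoid.trans' _ (key i hi) (Setoid.symm' _ (key j hj))

lemma sideMatchingTerm_le : sideMatchingTerm parity matching leftMatching ≤
    (kerOn fun i => if i ≤ 0 then (i + 1) / 2 else i + 1 : Setoid (Segment a b)) := by
  have h : (leftMatching ⊔ sideTerm parity matching leftMatching : Setoid (Segment a b)) ≤
      kerOn fun i => if i ≤ 0 then 0 else i := by
    refine sup_le (fun i j h => ?_) fun i j h => ?_
    · rw [leftMatching_apply] at h; rw [kerOn_apply]; split_ifs <;> omega
    · replace h := sideTerm_le h
      rw [kerOn_apply] at *
      split_ifs at h ⊢ <;> omega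
  rintro i j ⟨h1, h2⟩
  replace h2 := h h2
  rw [matching_apply] at h1
  rw [kerOn_apply] at *
  split_ifs at h2 ⊢ <;> omega

lemma sideMatchingTerm_rel (ha : 2 ≤ a) (hb : 0 < b) (hi : i.1 ≤ 0) (hj : j.1 ≤ 0)
    (h : (i.1 + 1) / 2 = (j.1 + 1) / 2) : sideMatchingTerm parity matching leftMatching i j :=
  ⟨h, leftMatching_sup_sideTerm_rel ha hb hi hj⟩

/-! ### Values of the link, step and walk terms -/

lemma linkTerm_eq (ha : 2 ≤ a) (hb : 2 ≤ b) :
    linkTerm parity matching leftMatching rightMatching =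
      (atomAt (-2) 1 : Setoid (Segment a b)) := by
  apply le_antisymm
  -- The point `-2` is attached through `-1` to the odd class on the right, hence its label `1`. In
  -- `h2`, symmetrically, `1` is attached through `0` to the even class on the left.
  · have h1 : (leftMatching ⊔ sideTerm parity matching rightMatching : Setoid (Segment a b)) ≤
        kerOn fun i => if i = -2 then 1 else if -1 ≤ i then i % 2 else 2 * (i / 2) := by
      refine sup_le (fun i j h => ?_) fun i j h => ?_
      · rw [leftMatching_apply] at h; rw [kerOn_apply]; split_ifs <;> omega
      · replace h := sideTerm_right_le h
        rw [kerOn_apply] at *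
        split_ifs at h ⊢ <;> omega
    have h2 : (rightMatching ⊔ sideTerm parity matching leftMatching : Setoid (Segment a b)) ≤
        kerOn fun i => if i = 1 then 0 else if i ≤ 0 then i % 2 else 2 * (i / 2) := by
      refine sup_le (fun i j h => ?_) fun i j h => ?_
      · rw [rightMatching_apply] at h; rw [kerOn_apply]; split_ifs <;> omega
      · replace h := sideTerm_le h
        rw [kerOn_apply] at *
        split_ifs at h ⊢ <;> omega
    rintro i j ⟨h, h'⟩
    replace h := h1 h
    replace h' := h2 h'
    rw [kerOn_apply] at *
    rw [atomAt_apply]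
    split_ifs at h h' <;> omega
  · refine atomAt_le fun hx hy => ⟨?_, ?_⟩
    · refine Setoid.trans' _ (y := ⟨-1, by omega⟩)
        (sup_rel_left (leftMatching_apply.2 (by simp))) (sup_rel_right ⟨by simp [parity_apply], ?_⟩)
      exact Setoid.trans' _ (y := ⟨0, by omega⟩) (sup_rel_left (matching_apply.2 (by simp)))
        (sup_rel_right (rightMatching_apply.2 (by simp)))
    · exact Setoid.trans' _ (y := ⟨0, by omega⟩)
        (sup_rel_right (sideTerm_rel (by omega) (by simp) (by simp) (by simp)))
        (sup_rel_left (rightMatching_apply.2 (by simp)))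

lemma stepTerm_atomAt (ha : 2 ≤ a) (hb : 0 < b) (k : ℤ) (hk : 0 ≤ k) :
    stepTerm parity matching leftMatching (atomAt (-2 - 2 * k) 1) =
      (atomAt (-3 - 2 * k) 1 : Setoid (Segment a b)) := by
  apply le_antisymm
  -- The label `2` is the one that the last branch gives to the point `1`; the only large block is
  -- `{-3 - 2k, -2 - 2k, 1}`, and parity then drops its even member.
  · have h1 : (sideMatchingTerm parity matching leftMatching ⊔ atomAt (-2 - 2 * k) 1 :
        Setoid (Segment a b)) ≤ kerOn fun i => if i = -2 - 2 * k ∨ i = -3 - 2 * k then 2 else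
          if i ≤ 0 then (i + 1) / 2 else i + 1 := by
      refine sup_le (fun i j h => ?_) fun i j h => ?_
      · replace h := sideMatchingTerm_le h
        rw [kerOn_apply] at *
        split_ifs at h ⊢ <;> omega
      · rw [atomAt_apply] at h; rw [kerOn_apply]; split_ifs <;> omega
    rintro i j ⟨h, h'⟩
    replace h' := h1 h'
    rw [parity_apply] at h
    rw [kerOn_apply] at h'
    rw [atomAt_apply]
    split_ifs at h' <;> omega
  · refine atomAt_le fun hx hy => ⟨by rw [parity_apply]; simp only; omega, ?_⟩
    refine Setoid.trans' _ (y := ⟨-2 - 2 * k, by omega⟩) (sup_rel_left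
      (sideMatchingTerm_rel ha hb ?_ ?_ ?_)) (sup_rel_right (atomAt_apply.2 (by simp)))
    all_goals simp only; omega

lemma walk_step (hb : 2 ≤ b) (k : ℤ) (hk : 0 ≤ k) :
    (leftMatching ⊔ atomAt (-3 - 2 * k) 1) ⊓
      (sideTerm parity matching leftMatching ⊔ atomAt (-2) 1) =
      (atomAt (-4 - 2 * k) 1 : Setoid (Segment a b)) := by
  apply le_antisymm
  · have h1 : (leftMatching ⊔ atomAt (-3 - 2 * k) 1 : Setoid (Segment a b)) ≤
        kerOn fun i => if i = -3 - 2 * k ∨ i = -4 - 2 * k then 1 else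
          if i < 0 then 2 * (i / 2) else i := by
      refine sup_le (fun i j h => ?_) fun i j h => ?_
      · rw [leftMatching_apply] at h; rw [kerOn_apply]; split_ifs <;> omega
      · rw [atomAt_apply] at h; rw [kerOn_apply]; split_ifs <;> omega
    have h2 : (sideTerm parity matching leftMatching ⊔ atomAt (-2) 1 : Setoid (Segment a b)) ≤
        kerOn fun i => if i = 1 then 0 else if i ≤ 0 then i % 2 else i := by
      refine sup_le (fun i j h => ?_) fun i j h => ?_
      · replace h := sideTerm_le h
        rw [kerOn_apply] at *
        split_ifs at h ⊢ <;> omega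
      · rw [atomAt_apply] at h; rw [kerOn_apply]; split_ifs <;> omega
    rintro i j ⟨h, h'⟩
    replace h := h1 h
    replace h' := h2 h'
    rw [kerOn_apply] at *
    rw [atomAt_apply]
    split_ifs at h h' <;> omega
  · refine atomAt_le fun hx hy => ⟨?_, ?_⟩
    · refine Setoid.trans' _ (y := ⟨-3 - 2 * k, by omega⟩)
        (sup_rel_left (leftMatching_apply.2 ?_)) (sup_rel_right (atomAt_apply.2 (by simp)))
      simp only; omega
    · refine Setoid.trans' _ (y := ⟨-2, by omega⟩)
        (sup_rel_left (sideTerm_rel (by omega) ?_ ?_ ?_)) (sup_rel_right (atomAt_apply.2 (by simp)))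
      all_goals simp only; omega

lemma walkTerm_eq (ha : 2 ≤ a) (hb : 2 ≤ b) (k : ℕ) :
    walkTerm parity matching leftMatching rightMatching k =
      (atomAt (-2 - 2 * k) 1 : Setoid (Segment a b)) := by
  induction k with
  | zero => simpa [walkTerm] using linkTerm_eq ha hb
  | succ k ih =>
    rw [walkTerm, ih, stepTerm_atomAt ha (by omega) k (by omega), linkTerm_eq ha hb,
      walk_step hb k (by omega)]
    congr 1
    push_cast
    ring

end

/-! ### Reflection -/

/-- Reflection of a segment about `-1/2`. -/
def reflect (a b : ℕ) : Segment a b ≃ Segment b a where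
  toFun i := ⟨-1 - i.1, by have := i.2; omega⟩
  invFun i := ⟨-1 - i.1, by have := i.2; omega⟩
  left_inv i := Subtype.ext (by simp)
  right_inv i := Subtype.ext (by simp)

end Segment

/-- Order isomorphism of equivalence lattices induced by an equivalence of types. -/
def Equiv.setoidOrderIso {V W : Type*} (e : V ≃ W) : Setoid W ≃o Setoid V where
  toFun := Setoid.comap e
  invFun := Setoid.comap e.symm
  left_inv X := Setoid.ext fun i j => by simp [Setoid.comap_rel]
  right_inv X := Setoid.ext fun i j => by simp [Setoid.comap_rel]
  map_rel_iff' {X Y} := by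
    refine ⟨fun h i j hij => ?_, fun h i j hij => h hij⟩
    have := @h (e.symm i) (e.symm j) (by
      change X (e (e.symm i)) (e (e.symm j))
      rwa [e.apply_symm_apply, e.apply_symm_apply])
    change Y (e (e.symm i)) (e (e.symm j)) at this
    rwa [e.apply_symm_apply, e.apply_symm_apply] at this

namespace Segment

variable {a b : ℕ}

/-- The map `i ↦ -1 - i` preserves α and β and exchanges γ with δ, so results about the left side
transfer to the right with `a` and `b` exchanged. -/
lemma comap_reflect_parity : Setoid.comap (reflect a b) parity = parity :=
  Setoid.ext fun i j => by
    simp only [Setoid.comap_rel, parity_apply, reflect, Equiv.coe_fn_mk]; omega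

lemma comap_reflect_matching : Setoid.comap (reflect a b) matching = matching :=
  Setoid.ext fun i j => by
    simp only [Setoid.comap_rel, matching_apply, reflect, Equiv.coe_fn_mk]; omega

lemma comap_reflect_leftMatching : Setoid.comap (reflect a b) leftMatching = rightMatching :=
  Setoid.ext fun i j => by
    simp only [Setoid.comap_rel, leftMatching_apply, rightMatching_apply, reflect,
      Equiv.coe_fn_mk]; omega

lemma comap_reflect_rightMatching : Setoid.comap (reflect a b) rightMatching = leftMatching :=
  Setoid.ext fun i j => by
    simp only [Setoid.comap_rel, leftMatching_apply, rightMatching_apply, reflect,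
      Equiv.coe_fn_mk]; omega

lemma comap_reflect_atomAt (x y : ℤ) :
    Setoid.comap (reflect a b) (atomAt x y) = atomAt (-1 - x) (-1 - y) :=
  Setoid.ext fun i j => by
    simp only [Setoid.comap_rel, atomAt_apply, reflect, Equiv.coe_fn_mk]; omega

/-- The lattice homomorphism induced by reflection. -/
def reflectHom (a b : ℕ) : LatticeHom (Setoid (Segment b a)) (Setoid (Segment a b)) where
  toFun := (reflect a b).setoidOrderIso
  map_sup' := map_sup _
  map_inf' := map_inf _

lemma walkTerm_right_eq (ha : 2 ≤ a) (hb : 2 ≤ b) (k : ℕ) :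
    walkTerm parity matching rightMatching leftMatching k =
      (atomAt (2 * k + 1) (-2) : Setoid (Segment a b)) := by
  have h := congrArg (reflectHom a b) (walkTerm_eq hb ha k)
  rw [map_walkTerm] at h
  change walkTerm (Setoid.comap (reflect a b) _) (Setoid.comap (reflect a b) _)
    (Setoid.comap (reflect a b) _) (Setoid.comap (reflect a b) _) k =
    Setoid.comap (reflect a b) _ at h
  rw [comap_reflect_parity, comap_reflect_matching, comap_reflect_leftMatching,
    comap_reflect_rightMatching, comap_reflect_atomAt] at h
  rw [h]
  congr 1
  ring

lemma stepTerm_right_atomAt (ha : 0 < a) (hb : 2 ≤ b) (k : ℤ) (hk : 0 ≤ k) :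
    stepTerm parity matching rightMatching (atomAt (2 * k + 1) (-2)) =
      (atomAt (2 * k + 2) (-2) : Setoid (Segment a b)) := by
  have h := congrArg (reflectHom a b) (stepTerm_atomAt hb ha k hk)
  rw [map_stepTerm] at h
  change stepTerm (Setoid.comap (reflect a b) _) (Setoid.comap (reflect a b) _)
    (Setoid.comap (reflect a b) _) (Setoid.comap (reflect a b) _) =
    Setoid.comap (reflect a b) _ at h
  rw [comap_reflect_parity, comap_reflect_matching, comap_reflect_leftMatching,
    comap_reflect_atomAt, comap_reflect_atomAt] at h
  convert h using 2 <;> ring_nf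

end Segment

namespace Segment

variable {a b : ℕ}

/-! ### The generators generate -/

lemma matching_sup_rightMatching_rel {i j : Segment a b} (ha : 0 < a) (hi : -1 ≤ i.1)
    (hj : -1 ≤ j.1) : (matching ⊔ rightMatching) i j := by
  have h : Setoid.comap (reflect a b) (matching ⊔ leftMatching) = matching ⊔ rightMatching := by
    have := (reflectHom a b).map_sup' matching leftMatching
    change Setoid.comap (reflect a b) _ =
      Setoid.comap (reflect a b) _ ⊔ Setoid.comap (reflect a b) _ at this
    rwa [comap_reflect_matching, comap_reflect_leftMatching] at this
  rw [← h]
  refine matching_sup_leftMatching_rel (i := reflect a b i) (j := reflect a b j) ha ?_ ?_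
  · change -1 - i.1 ≤ 0; omega
  · change -1 - j.1 ≤ 0; omega

lemma parity_inf_matching : (parity ⊓ matching : Setoid (Segment a b)) = ⊥ := by
  rw [eq_bot_iff]
  rintro i j ⟨h1, h2⟩
  rw [parity_apply] at h1
  rw [matching_apply] at h2
  exact Subtype.ext (by omega)

lemma parity_inf_leftMatching : (parity ⊓ leftMatching : Setoid (Segment a b)) = ⊥ := by
  rw [eq_bot_iff]
  rintro i j ⟨h1, h2⟩
  rw [parity_apply] at h1
  rw [leftMatching_apply] at h2
  exact Subtype.ext (by omega)

lemma parity_inf_rightMatching : (parity ⊓ rightMatching : Setoid (Segment a b)) = ⊥ := by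
  rw [eq_bot_iff]
  rintro i j ⟨h1, h2⟩
  rw [parity_apply] at h1
  rw [rightMatching_apply] at h2
  exact Subtype.ext (by omega)

/-- The left factor is β on `i ≤ 0`, the right one has the single large block `-1 ≤ i`; they overlap
only in `{-1, 0}`. -/
lemma central_edge_eq (ha : 2 ≤ a) (hb : 2 ≤ b) :
    sideMatchingTerm parity matching leftMatching ⊓
      (rightMatching ⊔ sideTerm parity matching rightMatching) =
      (atomAt (-1) 0 : Setoid (Segment a b)) := by
  apply le_antisymm
  · have h2 : (rightMatching ⊔ sideTerm parity matching rightMatching : Setoid (Segment a b)) ≤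
        kerOn fun i => if -1 ≤ i then 0 else i := by
      refine sup_le (fun i j h => ?_) fun i j h => ?_
      · rw [rightMatching_apply] at h; rw [kerOn_apply]; split_ifs <;> omega
      · replace h := sideTerm_right_le h
        rw [kerOn_apply] at *
        split_ifs at h ⊢ <;> omega
    rintro i j ⟨h, h'⟩
    replace h := sideMatchingTerm_le h
    replace h' := h2 h'
    rw [kerOn_apply] at *
    rw [atomAt_apply]
    split_ifs at h h' <;> omega
  · refine atomAt_le fun hx hy => ⟨sideMatchingTerm_rel ha (by omega) ?_ ?_ ?_, ?_⟩
    · simp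
    · simp
    · simp
    · refine Setoid.trans' _ (y := ⟨1, by omega⟩) (sup_rel_right ⟨by simp [parity_apply], ?_⟩)
        (sup_rel_left (rightMatching_apply.2 (by simp)))
      exact matching_sup_rightMatching_rel (by omega) (by simp) (by simp)

/-- The points `-2, 1, 0, -1` form a path in the join, and the edge `{-2, -1}` is the only edge of γ
inside a block of that join. -/
lemma left_edge_eq (hb : 2 ≤ b) :
    leftMatching ⊓ (atomAt (-1) 0 ⊔ rightMatching ⊔ atomAt (-2) 1) =
      (atomAt (-2) (-1) : Setoid (Segment a b)) := by
  apply le_antisymm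
  · have h2 : (atomAt (-1) 0 ⊔ rightMatching ⊔ atomAt (-2) 1 : Setoid (Segment a b)) ≤
        kerOn fun i => if -2 ≤ i ∧ i ≤ 1 then 0 else if i < 0 then i else 2 * (i / 2) := by
      refine sup_le (sup_le (fun i j h => ?_) fun i j h => ?_) fun i j h => ?_
      · rw [atomAt_apply] at h; rw [kerOn_apply]; split_ifs <;> omega
      · rw [rightMatching_apply] at h; rw [kerOn_apply]; split_ifs <;> omega
      · rw [atomAt_apply] at h; rw [kerOn_apply]; split_ifs <;> omega
    rintro i j ⟨h, h'⟩
    replace h' := h2 h'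
    rw [leftMatching_apply] at h
    rw [kerOn_apply] at h'
    rw [atomAt_apply]
    split_ifs at h' <;> omega
  · refine atomAt_le fun hx hy => ⟨leftMatching_apply.2 (by simp), ?_⟩
    refine Setoid.trans' _ (y := ⟨1, by omega⟩) (sup_rel_right (atomAt_apply.2 (by simp)))
      (sup_rel_left ?_)
    exact Setoid.trans' _ (y := ⟨0, by omega⟩) (sup_rel_right (rightMatching_apply.2 (by simp)))
      (sup_rel_left (atomAt_apply.2 (by simp)))

lemma right_edge_eq (ha : 2 ≤ a) :
    rightMatching ⊓ (atomAt (-1) 0 ⊔ leftMatching ⊔ atomAt (-2) 1) =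
      (atomAt 0 1 : Setoid (Segment a b)) := by
  apply le_antisymm
  · have h2 : (atomAt (-1) 0 ⊔ leftMatching ⊔ atomAt (-2) 1 : Setoid (Segment a b)) ≤
        kerOn fun i => if -2 ≤ i ∧ i ≤ 1 then 0 else if i < 0 then 2 * (i / 2) else i := by
      refine sup_le (sup_le (fun i j h => ?_) fun i j h => ?_) fun i j h => ?_
      · rw [atomAt_apply] at h; rw [kerOn_apply]; split_ifs <;> omega
      · rw [leftMatching_apply] at h; rw [kerOn_apply]; split_ifs <;> omega
      · rw [atomAt_apply] at h; rw [kerOn_apply]; split_ifs <;> omega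
    rintro i j ⟨h, h'⟩
    replace h' := h2 h'
    rw [rightMatching_apply] at h
    rw [kerOn_apply] at h'
    rw [atomAt_apply]
    split_ifs at h' <;> omega
  · refine atomAt_le fun hx hy => ⟨rightMatching_apply.2 (by simp), ?_⟩
    refine Setoid.trans' _ (y := ⟨-2, by omega⟩) (sup_rel_left ?_)
      (sup_rel_right (atomAt_apply.2 (by simp)))
    exact Setoid.trans' _ (y := ⟨-1, by omega⟩) (sup_rel_left (atomAt_apply.2 (by simp)))
      (sup_rel_right (leftMatching_apply.2 (by simp)))

/-- The atoms `{-2, -1}`, `{-1, 0}`, `{0, 1}`, `{-2, 1}` form a 4-cycle. They extend the two walks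
to full stars of atoms at `-2` and `1`, and any `{x, y}` is then a diagonal of the square `x, -2, y,
1`. -/
theorem eq_univ_of_isSublattice (ha : 2 ≤ a) (hb : 2 ≤ b) {T : Set (Setoid (Segment a b))}
    (hT : IsSublattice T) (hα : parity ∈ T) (hβ : matching ∈ T) (hγ : leftMatching ∈ T)
    (hδ : rightMatching ∈ T) : T = Set.univ := by
  have hbot : ⊥ ∈ T := parity_inf_matching ▸ hT.infClosed hα hβ
  obtain ⟨m2, hm2⟩ : ∃ x : Segment a b, x.1 = -2 := ⟨⟨-2, by omega⟩, rfl⟩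
  obtain ⟨m1, hm1⟩ : ∃ x : Segment a b, x.1 = -1 := ⟨⟨-1, by omega⟩, rfl⟩
  obtain ⟨z, hz⟩ : ∃ x : Segment a b, x.1 = 0 := ⟨⟨0, by omega⟩, rfl⟩
  obtain ⟨p1, hp1⟩ : ∃ x : Segment a b, x.1 = 1 := ⟨⟨1, by omega⟩, rfl⟩
  have hL : ∀ x : Segment a b, x.1 ≤ -2 → pairSetoid x p1 ∈ T := by
    intro x hx
    have hw (k : ℕ) := hT.walkTerm_mem hα hβ hγ hδ k
    have hs (k : ℕ) := hT.stepTerm_mem hα hβ hγ (hw k)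
    simp only [walkTerm_eq ha hb] at hw hs
    simp only [stepTerm_atomAt ha (show 0 < b by omega) _ (Int.natCast_nonneg _)] at hs
    obtain ⟨k, hk⟩ : ∃ k : ℕ, x.1 = -2 - 2 * k ∨ x.1 = -3 - 2 * k :=
      ⟨((-2 - x.1) / 2).toNat, by omega⟩
    rw [← atomAt_val, hp1]
    rcases hk with hk | hk <;> rw [hk]
    exacts [hw k, hs k]
  have hR : ∀ x : Segment a b, 1 ≤ x.1 → pairSetoid x m2 ∈ T := by
    intro x hx
    have hw (k : ℕ) := hT.walkTerm_mem hα hβ hδ hγ k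
    have hs (k : ℕ) := hT.stepTerm_mem hα hβ hδ (hw k)
    simp only [walkTerm_right_eq ha hb] at hw hs
    simp only [stepTerm_right_atomAt (show 0 < a by omega) hb _ (Int.natCast_nonneg _)] at hs
    obtain ⟨k, hk⟩ : ∃ k : ℕ, x.1 = 2 * k + 1 ∨ x.1 = 2 * k + 2 :=
      ⟨((x.1 - 1) / 2).toNat, by omega⟩
    rw [← atomAt_val, hm2]
    rcases hk with hk | hk <;> rw [hk]
    exacts [hw k, hs k]
  have hlink : pairSetoid m2 p1 ∈ T := hL m2 (by omega)
  have hcentral : pairSetoid m1 z ∈ T := by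
    rw [← atomAt_val, hm1, hz, ← central_edge_eq ha hb]
    exact hT.infClosed (hT.sideMatchingTerm_mem hα hβ hγ)
      (hT.supClosed hδ (hT.sideTerm_mem hα hβ hδ))
  have hleft : pairSetoid m2 m1 ∈ T := by
    rw [← atomAt_val, hm2, hm1, ← left_edge_eq hb, ← hm2, ← hm1, ← hz, ← hp1, atomAt_val,
      atomAt_val]
    exact hT.infClosed hγ (hT.supClosed (hT.supClosed hcentral hδ) hlink)
  have hright : pairSetoid z p1 ∈ T := by
    rw [← atomAt_val, hz, hp1, ← right_edge_eq ha, ← hm2, ← hm1, ← hz, ← hp1, atomAt_val,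
      atomAt_val]
    exact hT.infClosed hδ (hT.supClosed (hT.supClosed hcentral hγ) hlink)
  have comm {x y : Segment a b} (h : pairSetoid x y ∈ T) : pairSetoid y x ∈ T :=
    pairSetoid_comm x y ▸ h
  have hne {x y : Segment a b} (h : x.1 ≠ y.1) : x ≠ y := fun h' => h (h' ▸ rfl)
  have star_m2 : ∀ x, pairSetoid x m2 ∈ T := by
    intro x
    obtain h | h | h | h | h : x.1 ≤ -3 ∨ x.1 = -2 ∨ x.1 = -1 ∨ x.1 = 0 ∨ 1 ≤ x.1 := by omega
    -- β ⊔ γ joins all points `≤ 0` but not `1`, so it shortens the path `x, 1, -2` to `{x, -2}`.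
    · refine hT.pairSetoid_mem_of_separating (hT.supClosed hβ hγ) (hL x (by omega)) (comm hlink)
        (matching_sup_leftMatching_rel (by omega) (by omega) (by omega)) fun h' => ?_
      replace h' := matching_sup_leftMatching_le h'
      rw [kerOn_apply] at h'
      split_ifs at h' <;> omega
    · obtain rfl : x = m2 := Subtype.ext (by omega)
      rwa [pairSetoid_self]
    · obtain rfl : x = m1 := Subtype.ext (by omega)
      exact comm hleft
    · obtain rfl : x = z := Subtype.ext (by omega)
      exact hT.pairSetoid_mem_of_square hright (comm hlink) (comm hcentral) (comm hleft)
        (hne (by omega))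
    · exact hR x h
  have star_p1 : ∀ x, pairSetoid x p1 ∈ T := by
    intro x
    obtain h | h | h | h | h : x.1 ≤ -2 ∨ x.1 = -1 ∨ x.1 = 0 ∨ x.1 = 1 ∨ 2 ≤ x.1 := by omega
    · exact hL x h
    · obtain rfl : x = m1 := Subtype.ext (by omega)
      exact hT.pairSetoid_mem_of_square hcentral hright (comm hleft) hlink (hne (by omega))
    · obtain rfl : x = z := Subtype.ext (by omega)
      exact hright
    · obtain rfl : x = p1 := Subtype.ext (by omega)
      rwa [pairSetoid_self]
    · refine hT.pairSetoid_mem_of_separating (hT.supClosed hβ hδ) (hR x (by omega)) hlink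
        (matching_sup_rightMatching_rel (by omega) (by omega) (by omega)) fun h' => ?_
      replace h' := matching_sup_rightMatching_le h'
      rw [kerOn_apply] at h'
      split_ifs at h' <;> omega
  exact hT.eq_univ_of_pairSetoid_mem (fun x y => hT.pairSetoid_mem_of_square (star_m2 x)
    (comm (star_m2 y)) (star_p1 x) (comm (star_p1 y)) (hne (by omega))) hbot

/-! ### Separating segments by a term -/

lemma matchings_sup_eq_top (ha : 0 < a) (hb : 0 < b) :
    (matching ⊔ leftMatching ⊔ rightMatching : Setoid (Segment a b)) = ⊤ := by
  have key : ∀ i : Segment a b, (matching ⊔ leftMatching ⊔ rightMatching) i ⟨0, by omega⟩ := by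
    intro i
    rcases le_total i.1 0 with h | h
    · exact sup_rel_left (matching_sup_leftMatching_rel hb h le_rfl)
    · have := matching_sup_rightMatching_rel (j := ⟨0, by omega⟩) ha (show -1 ≤ i.1 by omega)
        (by simp)
      exact (sup_le_sup_right le_sup_left _ :
        (matching ⊔ rightMatching : Setoid (Segment a b)) ≤ _) this
  rw [eq_top_iff]
  intro i j _
  exact Setoid.trans' _ (key i) (Setoid.symm' _ (key j))

lemma spreadTerm_bot :
    spreadTerm parity matching leftMatching rightMatching (⊥ : Setoid (Segment a b)) = ⊥ := by
  simp only [spreadTerm, bot_sup_eq, inf_comm _ parity, parity_inf_matching,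
    parity_inf_leftMatching, parity_inf_rightMatching, sup_bot_eq]

/-- An atom joining opposite parities merges the two classes of α, leaving β ⊔ γ ⊔ δ, which connects
the whole path. -/
lemma spreadTerm_atomAt (ha : 0 < a) (hb : 0 < b) {x y : ℤ} (hx : -(a : ℤ) ≤ x ∧ x < b)
    (hy : -(a : ℤ) ≤ y ∧ y < b) (hxy : x % 2 ≠ y % 2) :
    spreadTerm parity matching leftMatching rightMatching
      (atomAt x y : Setoid (Segment a b)) = ⊤ := by
  have h : (atomAt x y ⊔ parity : Setoid (Segment a b)) = ⊤ := by
    have key : ∀ i : Segment a b, (atomAt x y ⊔ parity) i ⟨x, hx⟩ := by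
      intro i
      by_cases h : i.1 % 2 = x % 2
      · exact sup_rel_right h
      · refine Setoid.trans' _ (y := ⟨y, hy⟩) (sup_rel_right ?_)
          (sup_rel_left (atomAt_apply.2 (by simp)))
        rw [parity_apply]; simp only; omega
    rw [eq_top_iff]
    intro i j _
    exact Setoid.trans' _ (key i) (Setoid.symm' _ (key j))
  rw [spreadTerm, h, inf_top_eq, inf_top_eq, inf_top_eq, matchings_sup_eq_top ha hb]

lemma spreadTerm_walkTerm_eq_top (hb : 2 ≤ b) {k : ℕ} (hk : 2 * k + 2 ≤ a) :
    spreadTerm parity matching leftMatching rightMatching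
      (walkTerm parity matching leftMatching rightMatching k : Setoid (Segment a b)) = ⊤ := by
  rw [walkTerm_eq (by omega) hb]
  exact spreadTerm_atomAt (by omega) (by omega) (by omega) (by omega) (by omega)

lemma spreadTerm_walkTerm_eq_bot (ha : 2 ≤ a) (hb : 2 ≤ b) {k : ℕ} (hk : a < 2 * k + 2) :
    spreadTerm parity matching leftMatching rightMatching
      (walkTerm parity matching leftMatching rightMatching k : Setoid (Segment a b)) = ⊥ := by
  rw [walkTerm_eq ha hb, le_bot_iff.1 (atomAt_le fun hx _ => by omega), spreadTerm_bot]

lemma spreadTerm_walkTerm_right_eq_top (ha : 2 ≤ a) {k : ℕ} (hk : 2 * k + 2 ≤ b) :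
    spreadTerm parity matching leftMatching rightMatching
      (walkTerm parity matching rightMatching leftMatching k : Setoid (Segment a b)) = ⊤ := by
  rw [walkTerm_right_eq ha (by omega)]
  exact spreadTerm_atomAt (by omega) (by omega) (by omega) (by omega) (by omega)

lemma spreadTerm_walkTerm_right_eq_bot (ha : 2 ≤ a) (hb : 2 ≤ b) {k : ℕ} (hk : b < 2 * k + 2) :
    spreadTerm parity matching leftMatching rightMatching
      (walkTerm parity matching rightMatching leftMatching k : Setoid (Segment a b)) = ⊥ := by
  rw [walkTerm_right_eq ha hb, le_bot_iff.1 (atomAt_le fun hx _ => by omega), spreadTerm_bot]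

end Segment

/-! ### Sublattices of finite products -/

/-- A sublattice of a finite product of bounded lattices that projects onto each factor and
separates any two factors is the whole product. -/
theorem IsSublattice.eq_univ_of_pi {ι : Type*} [Finite ι] [Nonempty ι] {L : ι → Type*}
    [∀ i, Lattice (L i)] [∀ i, BoundedOrder (L i)] {S : Set (∀ i, L i)} (hS : IsSublattice S)
    (hproj : ∀ i x, ∃ y ∈ S, y i = x)
    (hsep : ∀ i j, i ≠ j → ∃ y ∈ S, y i = ⊤ ∧ y j = ⊥) : S = Set.univ := by
  classical
  have := Fintype.ofFinite ι
  -- Meeting the separators of `i` from each `j ∈ s` keeps `⊤` at `i` and puts `⊥` on `s`.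
  have hunit : ∀ (i : ι) (s : Finset ι), i ∉ s → ∃ y ∈ S, y i = ⊤ ∧ ∀ j ∈ s, y j = ⊥ := by
    intro i s
    induction s using Finset.induction_on with
    | empty =>
      obtain ⟨y, hy, h⟩ := hproj i ⊤
      exact fun _ => ⟨y, hy, h, by simp⟩
    | insert j s _ ih =>
      intro hi
      rw [Finset.mem_insert, not_or] at hi
      obtain ⟨y, hy, hyi, hys⟩ := ih hi.2
      obtain ⟨w, hw, hwi, hwj⟩ := hsep i j hi.1
      refine ⟨y ⊓ w, hS.infClosed hy hw, by simp [hyi, hwi], fun k hk => ?_⟩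
      rcases Finset.mem_insert.1 hk with rfl | hk
      · simp [hwj]
      · simp [hys k hk]
  have hsingle : ∀ (i : ι) (x : L i), ∃ y ∈ S, y i = x ∧ ∀ j, j ≠ i → y j = ⊥ := by
    intro i x
    obtain ⟨e, he, hei, hej⟩ := hunit i (Finset.univ.erase i) (by simp)
    obtain ⟨y, hy, hyi⟩ := hproj i x
    exact ⟨e ⊓ y, hS.infClosed he hy, by simp [hei, hyi],
      fun j hj => by simp [hej j (by simp [hj])]⟩
  have hbot : ⊥ ∈ S := by
    obtain ⟨i⟩ := ‹Nonempty ι›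
    obtain ⟨y, hy, hyi, hyj⟩ := hsingle i ⊥
    have : y = ⊥ := funext fun j => by
      by_cases hj : j = i
      · subst hj; simpa using hyi
      · simpa using hyj j hj
    exact this ▸ hy
  refine Set.eq_univ_of_forall fun x => ?_
  choose f hf hfi hfj using fun i => hsingle i (x i)
  have hx : x = Finset.univ.sup f := by
    funext i
    rw [Finset.sup_apply]
    refine le_antisymm ?_ (Finset.sup_le fun j _ => ?_)
    · exact (hfi i).symm.le.trans (Finset.le_sup (f := fun j => f j i) (Finset.mem_univ i))
    · by_cases hj : i = j
      · subst hj; exact (hfi i).le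
      · rw [hfj j i hj]; exact bot_le
  rw [hx]
  exact Finset.sup_induction hbot (fun _ h _ h' => hS.supClosed h h') fun i _ => hf i

/-! ### Four-generation -/

theorem IsFourGenerated.of_orderIso {L M : Type*} [Lattice L] [Lattice M] (e : L ≃o M)
    (h : IsFourGenerated L) : IsFourGenerated M := by
  classical
  obtain ⟨s, hs, hgen⟩ := h
  refine ⟨s.map e.toEquiv.toEmbedding, by simpa using hs, ?_⟩
  have := image_latticeClosure (s : Set L) e (map_sup e) (map_inf e)
  rw [hgen, Set.image_univ, e.surjective.range_eq] at this
  rw [this, Finset.coe_map]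
  rfl

theorem isFourGenerated_pi_setoid_segment {ι : Type*} [Finite ι] [Nonempty ι] (a b : ι → ℕ)
    (ha : ∀ p, 2 ≤ a p) (hb : ∀ p, 2 ≤ b p)
    (hsep : ∀ p q, p ≠ q → a q / 2 < a p / 2 ∨ b q / 2 < b p / 2) :
    IsFourGenerated (∀ p, Setoid (Segment (a p) (b p))) := by
  classical
  let α : ∀ p, Setoid (Segment (a p) (b p)) := fun _ => Segment.parity
  let β : ∀ p, Setoid (Segment (a p) (b p)) := fun _ => Segment.matching
  let γ : ∀ p, Setoid (Segment (a p) (b p)) := fun _ => Segment.leftMatching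
  let δ : ∀ p, Setoid (Segment (a p) (b p)) := fun _ => Segment.rightMatching
  obtain ⟨p₀⟩ := ‹Nonempty ι›
  have ha₀ := ha p₀
  have hb₀ := hb p₀
  -- Distinctness of the generators is checked in the single factor `p₀`.
  have ne_of_rel {X Y : ∀ p, Setoid (Segment (a p) (b p))} (x y : ℤ)
      (hx : -(a p₀ : ℤ) ≤ x ∧ x < b p₀) (hy : -(a p₀ : ℤ) ≤ y ∧ y < b p₀)
      (h : X p₀ ⟨x, hx⟩ ⟨y, hy⟩) (h' : ¬ Y p₀ ⟨x, hx⟩ ⟨y, hy⟩) : X ≠ Y := by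
    rintro rfl
    exact h' h
  have hαβ : α ≠ β := ne_of_rel (-2) 0 (by omega) (by omega)
    (by simp [α, Segment.parity_apply]) (by simp [β, Segment.matching_apply])
  have hαγ : α ≠ γ := ne_of_rel (-2) 0 (by omega) (by omega)
    (by simp [α, Segment.parity_apply]) (by simp [γ, Segment.leftMatching_apply])
  have hαδ : α ≠ δ := ne_of_rel (-2) 0 (by omega) (by omega)
    (by simp [α, Segment.parity_apply]) (by simp [δ, Segment.rightMatching_apply])
  have hβγ : β ≠ γ := ne_of_rel (-1) 0 (by omega) (by omega)
    (by simp [β, Segment.matching_apply]) (by simp [γ, Segment.leftMatching_apply])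
  have hβδ : β ≠ δ := ne_of_rel (-1) 0 (by omega) (by omega)
    (by simp [β, Segment.matching_apply]) (by simp [δ, Segment.rightMatching_apply])
  have hγδ : γ ≠ δ := ne_of_rel (-2) (-1) (by omega) (by omega)
    (by simp [γ, Segment.leftMatching_apply]) (by simp [δ, Segment.rightMatching_apply])
  refine ⟨{α, β, γ, δ}, ?_, ?_⟩
  · rw [Finset.card_insert_of_notMem, Finset.card_insert_of_notMem, Finset.card_insert_of_notMem,
      Finset.card_singleton] <;> simp only [Finset.mem_insert, Finset.mem_singleton, not_or]
    exacts [hγδ, ⟨hβγ, hβδ⟩, ⟨hαβ, hαγ, hαδ⟩]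
  set S := latticeClosure ((({α, β, γ, δ} : Finset _)) : Set (∀ p, Setoid (Segment (a p) (b p))))
  have hS : IsSublattice S := isSublattice_latticeClosure
  have hα : α ∈ S := subset_latticeClosure (by simp)
  have hβ : β ∈ S := subset_latticeClosure (by simp)
  have hγ : γ ∈ S := subset_latticeClosure (by simp)
  have hδ : δ ∈ S := subset_latticeClosure (by simp)
  let ev (p : ι) : LatticeHom (∀ p, Setoid (Segment (a p) (b p))) (Setoid (Segment (a p) (b p))) :=
    { toFun := fun f => f p, map_sup' := fun _ _ => rfl, map_inf' := fun _ _ => rfl }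
  have : Nonempty ι := ⟨p₀⟩
  refine hS.eq_univ_of_pi (fun p x => ?_) fun p q hpq => ?_
  · have himage : IsSublattice (ev p '' S) := by
      refine ⟨?_, ?_⟩
      · rintro _ ⟨f, hf, rfl⟩ _ ⟨g, hg, rfl⟩
        exact ⟨f ⊔ g, hS.supClosed hf hg, rfl⟩
      · rintro _ ⟨f, hf, rfl⟩ _ ⟨g, hg, rfl⟩
        exact ⟨f ⊓ g, hS.infClosed hf hg, rfl⟩
    have := Segment.eq_univ_of_isSublattice (ha p) (hb p) himage ⟨α, hα, rfl⟩ ⟨β, hβ, rfl⟩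
      ⟨γ, hγ, rfl⟩ ⟨δ, hδ, rfl⟩
    have hx : x ∈ ev p '' S := this ▸ Set.mem_univ x
    exact hx
  · have hap := ha p
    have hbp := hb p
    rcases hsep p q hpq with h | h
    -- `a p / 2 - 1` is the last `k` whose walk stays inside the segment of `p`; that of `q` is
    -- already too short.
    · refine ⟨spreadTerm α β γ δ (walkTerm α β γ δ (a p / 2 - 1)), hS.spreadTerm_mem hα hβ hγ hδ
        (hS.walkTerm_mem hα hβ hγ hδ _), ?_, ?_⟩
      · refine (map_spreadTerm (ev p) α β γ δ _).trans ?_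
        rw [map_walkTerm]
        exact Segment.spreadTerm_walkTerm_eq_top (hb p) (by omega)
      · refine (map_spreadTerm (ev q) α β γ δ _).trans ?_
        rw [map_walkTerm]
        exact Segment.spreadTerm_walkTerm_eq_bot (ha q) (hb q) (by omega)
    · refine ⟨spreadTerm α β γ δ (walkTerm α β δ γ (b p / 2 - 1)), hS.spreadTerm_mem hα hβ hγ hδ
        (hS.walkTerm_mem hα hβ hδ hγ _), ?_, ?_⟩
      · refine (map_spreadTerm (ev p) α β γ δ _).trans ?_
        rw [map_walkTerm]
        exact Segment.spreadTerm_walkTerm_right_eq_top (ha p) (by omega)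
      · refine (map_spreadTerm (ev q) α β γ δ _).trans ?_
        rw [map_walkTerm]
        exact Segment.spreadTerm_walkTerm_right_eq_bot (ha q) (hb q) (by omega)

/-- Translation of `{0, …, m - 1}` onto a segment with `m` elements. -/
def finEquivSegment {m a b : ℕ} (h : a + b = m) : Fin m ≃ Segment a b where
  toFun k := ⟨(k : ℤ) - a, by have := k.2; omega⟩
  invFun i := ⟨(i.1 + a).toNat, by have := i.2; omega⟩
  left_inv k := Fin.ext (by simp)
  right_inv i := Subtype.ext (by have := i.2; simp only; omega)

theorem corollary3p5 (u : ℕ) (hu : 0 < u) :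
    ∃ N : ℕ, ∀ n : ℕ, N ≤ n →
      IsFourGenerated ((i : Fin u) → (Fin u → PartitionLattice (n + (i : ℕ)))) := by
  -- Since `r p < u * u`, every `a p` is at most `2 * u * (u * u) - 2 * u + 2`, which leaves `b p ≥
  -- 2`.
  refine ⟨2 * u * (u * u) + 4, fun n hn => ?_⟩
  have : Nonempty (Fin u × Fin u) := ⟨⟨⟨0, hu⟩, ⟨0, hu⟩⟩⟩
  let r (p : Fin u × Fin u) : ℕ := (finProdFinEquiv p : Fin (u * u))
  let a (p : Fin u × Fin u) : ℕ := 2 * (u * r p) + 2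
  let b (p : Fin u × Fin u) : ℕ := n + p.1 - a p
  have har (p) : u * r p + u ≤ u * (u * u) := by
    have : r p + 1 ≤ u * u := (finProdFinEquiv p).2
    calc u * r p + u = u * (r p + 1) := by ring
      _ ≤ _ := Nat.mul_le_mul_left u this
  have hn' : 2 * (u * (u * u)) + 4 ≤ n := by rw [← mul_assoc]; exact hn
  have hb (p) : 2 ≤ b p ∧ a p + b p = n + p.1 := by
    have := har p
    simp only [a, b]
    omega
  have hlt {p q} (h : r p < r q) : u * r p + u ≤ u * r q := by
    calc u * r p + u = u * (r p + 1) := by ring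
      _ ≤ _ := Nat.mul_le_mul_left u h
  let φ (p : Fin u × Fin u) : Setoid (Segment (a p) (b p)) ≃o PartitionLattice (n + p.1) :=
    (finEquivSegment (hb p).2).setoidOrderIso.trans (Setoid.Partition.orderIso _)
  let e : (∀ p : Fin u × Fin u, Setoid (Segment (a p) (b p))) ≃o
      ((i : Fin u) → (Fin u → PartitionLattice (n + (i : ℕ)))) :=
    { toFun := fun f i j => φ (i, j) (f (i, j))
      invFun := fun g p => (φ p).symm (g p.1 p.2)
      left_inv := fun f => funext fun p => (φ p).symm_apply_apply _
      right_inv := fun g => funext fun i => funext fun j => (φ (i, j)).apply_symm_apply _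
      map_rel_iff' := fun {f g} => by
        refine ⟨fun h p => (φ p).le_iff_le.1 (h p.1 p.2),
          fun h i j => (φ (i, j)).le_iff_le.2 (h _)⟩ }
  refine IsFourGenerated.of_orderIso e
    (isFourGenerated_pi_setoid_segment a b (fun p => by simp [a]) (fun p => (hb p).1) ?_)
  intro p q hpq
  have hr : r p ≠ r q := fun h => hpq (finProdFinEquiv.injective (Fin.ext h))
  have hp1 := p.1.2
  have hq1 := q.1.2
  have hbp := (hb p).2
  have hbq := (hb q).2
  -- If `r p < r q`, then `a q - a p ≥ 2 * u` while the lengths differ by at most `u - 1`; so `b p -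
  -- b q ≥ u + 1 ≥ 2`, enough for the halves to differ.
  rcases lt_or_gt_of_ne hr with h | h
  · right
    have := hlt h
    simp only [a] at hbp hbq
    omega
  · left
    have := hlt h
    simp only [a]
    omega
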